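/- Let $\mathbf{H}^2=\{(x,y): y>0\}$ be the hyperbolic plane with metric $(dx^2+dy^2)/y^2$, let $G$ be a group of isometries of $\mathbf{H}^2$ (possibly orientation reversing) acting freely and properly discontinuously, let $M=\mathbf{H}^2/G$ be the corresponding hyperbolic surface, and let $\pi\colon\mathbf{H}^2\to M$ be the projection. A closed curve in $M$ is a smooth regular map $\gamma\colon\mathbf{R}/L\mathbf{Z}\to M$, $L>0$, i.e. one with a smooth regular lift $c\colon\mathbf{R}\to\mathbf{H}^2$, $\pi(c(t))=\gamma(t \bmod L)$. It is a closed geodesic if a lift is a unit speed geodesic of $\mathbf{H}^2$, and a (closed) horocycle if, after composition with an isometry of $\mathbf{H}^2$, a lift is a horizontal line $t\mapsto(t,h)$, $h>0$; neither need be simple. A vertex of a closed curve is a critical point of its geodesic curvature (which is well defined locally up to sign). Lemma. Any closed geodesic or horocycle in a hyperbolic surface is $\mathcal{C}^\infty$-close to a closed curve with no more than two vertices. That is, if $\gamma\colon\mathbf{R}/L\mathbf{Z}\to M$ is a closed geodesic or horocycle, then for every lift $c$ of $\gamma$, every integer $k\ge 0$ and every $\varepsilon>0$ there is a closed curve $\gamma'\colon\mathbf{R}/L\mathbf{Z}\to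 M$ with at most two vertices that has a lift $c'$ such that $|c'^{(j)}(t)-c^{(j)}(t)|<\varepsilon$ for all $0\le j\le k$ and $0\le t\le L$, where $|\cdot|$ is the Euclidean norm in the coordinates $(x,y)$. -/

import Mathlib

open scoped UpperHalfPlane ContDiff

noncomputable section

namespace HyperbolicSurface

/-- A group of isometries of the hyperbolic plane `ℍ` (Mathlib's upper half-plane with its metric
of curvature `-1`; orientation-reversing isometries are allowed) that acts freely and properly
discontinuously. -/
structure IsSurfaceGroup (G : Subgroup (ℍ ≃ᵢ ℍ)) : Prop where
  free : ∀ g ∈ G, ∀ z : ℍ, g z = z → g = 1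
  properlyDiscontinuous : ∀ K : Set ℍ, IsCompact K →
    {g : ℍ ≃ᵢ ℍ | g ∈ G ∧ (g '' K ∩ K).Nonempty}.Finite

/-- Two points of `ℍ` are equivalent if they lie in the same orbit of `G`. -/
def orbitSetoid (G : Subgroup (ℍ ≃ᵢ ℍ)) : Setoid ℍ where
  r z w := ∃ g ∈ G, g z = w
  iseqv :=
    { refl := fun z => ⟨1, G.one_mem, rfl⟩
      symm := by
        rintro z w ⟨g, hg, rfl⟩
        exact ⟨g⁻¹, G.inv_mem hg, g.symm_apply_apply z⟩
      trans := by
        rintro z w u ⟨g, hg, rfl⟩ ⟨g', hg', rfl⟩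
        exact ⟨g' * g, G.mul_mem hg' hg, rfl⟩ }

/-- The surface `M = ℍ / G`. For a group `G` as in `IsSurfaceGroup` these are the complete
connected hyperbolic surfaces, orientable or not. -/
abbrev Surface (G : Subgroup (ℍ ≃ᵢ ℍ)) : Type := Quotient (orbitSetoid G)

/-- The covering projection `π : ℍ → ℍ / G`. -/
def proj (G : Subgroup (ℍ ≃ᵢ ℍ)) (z : ℍ) : Surface G := Quotient.mk (orbitSetoid G) z

/-- A curve in `ℍ`, read in the coordinate `x + i y`. -/
def coord (c : ℝ → ℍ) (t : ℝ) : ℂ := (c t : ℂ)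

/-- Smooth regular curves in `ℍ`. -/
def IsRegularCurve (c : ℝ → ℍ) : Prop :=
  ContDiff ℝ ∞ (coord c) ∧ ∀ t, deriv (coord c) t ≠ 0

/-- The length of `c'(t)` in the metric `(dx ^ 2 + dy ^ 2) / y ^ 2`. -/
def speed (c : ℝ → ℍ) (t : ℝ) : ℝ := ‖deriv (coord c) t‖ / (c t).im

/-- The covariant derivative `∇_{c'} c'` of the velocity for the Levi-Civita connection of
`(dx ^ 2 + dy ^ 2) / y ^ 2`. In real coordinates it is
`(x'' - 2 x' y' / y, y'' + (x' ^ 2 - y' ^ 2) / y)`. -/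
def covAccel (c : ℝ → ℍ) (t : ℝ) : ℂ :=
  deriv (deriv (coord c)) t + Complex.I * deriv (coord c) t ^ 2 / ((c t).im : ℂ)

/-- The signed geodesic curvature `⟨∇_{c'} c', J c'⟩ / |c'| ^ 3` of a curve in `ℍ`; the inner product
is the hyperbolic one and `J` is the rotation by a right angle (multiplication by `i`). -/
def geodesicCurvature (c : ℝ → ℍ) (t : ℝ) : ℝ :=
  (inner ℝ (covAccel c t) (Complex.I * deriv (coord c) t) / (c t).im ^ 2) / speed c t ^ 3

/-- `c` is a smooth regular curve in `ℍ` that lifts `γ : ℝ / L ℤ → ℍ / G`. -/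
def IsLift (G : Subgroup (ℍ ≃ᵢ ℍ)) {L : ℝ} (γ : AddCircle L → Surface G) (c : ℝ → ℍ) : Prop :=
  IsRegularCurve c ∧ ∀ t : ℝ, proj G (c t) = γ (t : AddCircle L)

/-- Smooth regular closed curves in `ℍ / G`, parametrized by `ℝ / L ℤ`. Since the projection is a
covering map and a local diffeomorphism, they are the maps that have a smooth regular lift. -/
def IsClosedCurve (G : Subgroup (ℍ ≃ᵢ ℍ)) {L : ℝ} (γ : AddCircle L → Surface G) : Prop :=
  ∃ c, IsLift G γ c

/-- Closed geodesics, parametrized by arclength; they need not be simple. -/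
def IsClosedGeodesic (G : Subgroup (ℍ ≃ᵢ ℍ)) {L : ℝ} (γ : AddCircle L → Surface G) : Prop :=
  ∃ c, IsLift G γ c ∧ (∀ t, speed c t = 1) ∧ ∀ t, covAccel c t = 0

/-- Closed horocycles: closed curves that lift, up to an isometry of `ℍ`, to a horizontal line
`t ↦ (t, h)`. -/
def IsClosedHorocycle (G : Subgroup (ℍ ≃ᵢ ℍ)) {L : ℝ} (γ : AddCircle L → Surface G) : Prop :=
  ∃ c, IsLift G γ c ∧ ∃ (A : ℍ ≃ᵢ ℍ) (h : ℝ), 0 < h ∧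
    ∀ t : ℝ, ((A (c t) : ℍ) : ℂ) = (t : ℂ) + (h : ℂ) * Complex.I

/-- `τ` is a vertex of `γ`: a critical point of the geodesic curvature. The curvature is computed in
a lift; another lift can only change its sign. -/
def IsVertex (G : Subgroup (ℍ ≃ᵢ ℍ)) {L : ℝ} (γ : AddCircle L → Surface G)
    (τ : AddCircle L) : Prop :=
  ∃ c, IsLift G γ c ∧ ∃ t : ℝ, (t : AddCircle L) = τ ∧ deriv (geodesicCurvature c) t = 0

/-- For a lift `c` of a closed curve `γ`, these sets (for `k : ℕ` and `ε > 0`) are the basic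
neighbourhoods of `γ` in the `C^∞` topology on closed curves: `γ'` belongs to the set if it has a
lift whose derivatives of order at most `k` are `ε`-close to those of `c`, uniformly over one
period. -/
def smoothNhd (G : Subgroup (ℍ ≃ᵢ ℍ)) (L : ℝ) (c : ℝ → ℍ) (k : ℕ) (ε : ℝ) :
    Set (AddCircle L → Surface G) :=
  {γ' | ∃ c', IsLift G γ' c' ∧ ∀ j ≤ k, ∀ t ∈ Set.Icc 0 L,
    ‖iteratedDeriv j (coord c') t - iteratedDeriv j (coord c) t‖ < ε}

end HyperbolicSurface

end

namespace HyperbolicSurface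

open UpperHalfPlane ComplexConjugate Filter Topology MatrixGroups

/-! After an isometry the given lift is `t ↦ i exp t` or `t ↦ t + h i`. A deck transformation `g`
shifts its parameter by `L`, and rigidity of isometries determines `g` in these coordinates: it is
`z ↦ z + L` for a horocycle, and `z ↦ exp L * z` or its composition with the reflection in the
imaginary axis for a geodesic.

The lift is perturbed by a cosine wave compatible with `g`: the height of the horocycle becomes `h
(1 + l cos (w t))`, the angle between the geodesic ray and the imaginary axis becomes `l cos (w t)`.
The frequency is `2π / L`, except that `π / L` serves when `g` reverses the angle, since the wave
must then change sign over one period. The perturbed curve is still `g`-equivariant and descends to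
a closed curve, which tends to the original one in `C^∞` as `l → 0`.

Its curvature has the form `F (cos (w t))`, and `F' / l` tends to a nonzero limit uniformly on `[-1,
1]`. For small `l ≠ 0` the only critical points are therefore the zeros of `sin (w t)`, at most two
per period (`exists_close_of_family`, `sin_eq_zero_of_deriv_eq_zero`).

Vertices are defined through arbitrary lifts, and normal forms use arbitrary isometries, so
isometries must be smooth and scale curvature by a nonzero constant. This follows from their
classification (`scalesCurvature_isometryEquiv`). -/

/-! ### Isometries of the hyperbolic plane -/

theorem exists_isometryEquiv_moebius (p q r s : ℝ) (h : p * s - q * r = 1) :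
    ∃ φ : ℍ ≃ᵢ ℍ, ∀ z : ℍ, (φ z : ℂ) = (p * z + q) / (r * z + s) := by
  let g : SL(2, ℝ) := ⟨!![p, q; r, s], by simp [Matrix.det_fin_two, h]⟩
  refine ⟨IsometryEquiv.constSMul g, fun z => ?_⟩
  rw [IsometryEquiv.constSMul_apply, coe_specialLinearGroup_apply]
  simp [g]

theorem denom_ne_zero_of_det {p q r s : ℝ} (h : p * s - q * r = 1) {z : ℂ} (hz : 0 < z.im) :
    (r * z + s : ℂ) ≠ 0 := by
  intro h0
  have him := congrArg Complex.im h0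
  have hre := congrArg Complex.re h0
  simp at him hre
  rcases him with rfl | him
  · simp at hre
    simp [hre] at h
  · exact hz.ne' him

/-- The hyperbolic metric in terms of real coordinates. -/
theorem dist_eq_dist_iff (z w z' w' : ℍ) : dist z w = dist z' w' ↔
    ((z.re - w.re) ^ 2 + (z.im - w.im) ^ 2) / (z.im * w.im) =
      ((z'.re - w'.re) ^ 2 + (z'.im - w'.im) ^ 2) / (z'.im * w'.im) := by
  rw [← Real.cosh_strictMonoOn.injOn.eq_iff (Set.mem_Ici.2 dist_nonneg) (Set.mem_Ici.2 dist_nonneg),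
    cosh_dist, cosh_dist]
  have key : ∀ a b : ℍ, dist (a : ℂ) b ^ 2 = (a.re - b.re) ^ 2 + (a.im - b.im) ^ 2 := fun a b => by
    rw [Complex.dist_eq, ← Complex.normSq_eq_norm_sq, Complex.normSq_apply]
    simp
    ring
  have half : ∀ a b c : ℝ, a / (2 * b * c) = a / (b * c) / 2 := fun a b c => by
    rw [div_div, mul_comm (b * c), mul_assoc]
  rw [key, key, add_right_inj, half, half, div_left_inj' two_ne_zero]

/-- An isometry fixing `i` and `2 i` is the identity or the reflection in the imaginary axis. -/
theorem eq_or_eq_neg_conj_of_fix (φ : ℍ ≃ᵢ ℍ) (a b : ℍ) (ha : (a : ℂ) = Complex.I)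
    (hb : (b : ℂ) = 2 * Complex.I) (h1 : φ a = a) (h2 : φ b = b) :
    (∀ z, φ z = z) ∨ ∀ z : ℍ, (φ z : ℂ) = -conj (z : ℂ) := by
  have hare : a.re = 0 := by rw [← coe_re, ha]; simp
  have haim : a.im = 1 := by rw [← coe_im, ha]; simp
  have hbre : b.re = 0 := by rw [← coe_re, hb]; simp
  have hbim : b.im = 2 := by rw [← coe_im, hb]; simp
  -- The distances to `i` and `2 i` determine a point up to the sign of its real part.
  have key : ∀ z, (φ z).im = z.im ∧ (φ z).re ^ 2 = z.re ^ 2 := by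
    intro z
    have e1 : dist (φ z) a = dist z a := by
      conv_lhs => rw [← h1]
      exact φ.dist_eq z a
    have e2 : dist (φ z) b = dist z b := by
      conv_lhs => rw [← h2]
      exact φ.dist_eq z b
    rw [dist_eq_dist_iff, hare, haim] at e1
    rw [dist_eq_dist_iff, hbre, hbim] at e2
    have hz := z.im_pos
    have hw := (φ z).im_pos
    field_simp at e1 e2
    have him : (φ z).im = z.im := by linarith
    refine ⟨him, ?_⟩
    rw [him] at e1
    have := mul_left_cancel₀ hz.ne' ((mul_comm _ _).trans e1)
    linarith
  -- The image of one point off the axis fixes the sign for all points at once.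
  obtain ⟨u, hu⟩ : ∃ u : ℍ, (u : ℂ) = 1 + Complex.I := ⟨⟨1 + Complex.I, by simp⟩, rfl⟩
  have hure : u.re = 1 := by rw [← coe_re, hu]; simp
  have huim : u.im = 1 := by rw [← coe_im, hu]; simp
  have hd : ∀ z, ((φ z).re - (φ u).re) ^ 2 = (z.re - 1) ^ 2 := by
    intro z
    have e := φ.dist_eq z u
    have hz := z.im_pos
    rw [dist_eq_dist_iff, (key z).1, (key u).1, hure, huim] at e
    field_simp at e
    linarith
  have hs : (φ u).re = 1 ∨ (φ u).re = -1 := by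
    have := (key u).2
    rw [hure, one_pow] at this
    simpa using this
  rcases hs with hs | hs
  · left
    intro z
    refine UpperHalfPlane.ext_re_im ?_ (key z).1
    have := hd z
    have := (key z).2
    rw [hs] at *
    linarith
  · right
    intro z
    have := hd z
    have := (key z).2
    rw [hs] at *
    apply Complex.ext
    · simp; linarith
    · simp [(key z).1]

/-- An isometry fixing a horocycle pointwise is the identity. -/
theorem eq_self_of_fix_horocycle (φ : ℍ ≃ᵢ ℍ) (h : ℝ) (hh : 0 < h)
    (hfix : ∀ w : ℍ, w.im = h → φ w = w) (z : ℍ) : φ z = z := by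
  have key : ∀ x : ℝ, (((φ z).re - x) ^ 2 + ((φ z).im - h) ^ 2) * z.im =
      ((z.re - x) ^ 2 + (z.im - h) ^ 2) * (φ z).im := by
    intro x
    obtain ⟨w, hwre, hwim⟩ : ∃ w : ℍ, w.re = x ∧ w.im = h := ⟨⟨⟨x, h⟩, hh⟩, rfl, rfl⟩
    have e : dist (φ z) w = dist z w := by
      conv_lhs => rw [← hfix w hwim]
      exact φ.dist_eq z w
    have hz := z.im_pos
    have hw := (φ z).im_pos
    rw [dist_eq_dist_iff, hwre, hwim] at e
    field_simp at e
    linarith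
  -- The second difference of `key` in `x` gives equal heights; a first difference then gives equal
  -- real parts.
  have h0 := key 0
  have h1 := key 1
  have h2 := key (-1)
  have him : (φ z).im = z.im := by linarith
  rw [him] at h0 h1
  refine UpperHalfPlane.ext_re_im ?_ him
  have e0 := mul_right_cancel₀ z.im_pos.ne' h0
  have e1 := mul_right_cancel₀ z.im_pos.ne' h1
  linarith

/-- Orientation preserving isometries, in the coordinate `x + i y`. -/
def IsMoebius (φ : ℍ → ℍ) : Prop :=
  ∃ p q r s : ℝ, p * s - q * r = 1 ∧ ∀ z : ℍ, (φ z : ℂ) = (p * z + q) / (r * z + s)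

theorem IsMoebius.comp {φ ψ : ℍ → ℍ} (hφ : IsMoebius φ) (hψ : IsMoebius ψ) :
    IsMoebius (φ ∘ ψ) := by
  obtain ⟨p, q, r, s, h, hφ⟩ := hφ
  obtain ⟨p', q', r', s', h', hψ⟩ := hψ
  have hdet : (p * p' + q * r') * (r * q' + s * s') - (p * q' + q * s') * (r * p' + s * r') = 1 := by
    linear_combination (p' * s' - q' * r') * h + h'
  refine ⟨_, _, _, _, hdet, fun z => ?_⟩
  have h1 := denom_ne_zero_of_det h' z.coe_im_pos
  have h2 := denom_ne_zero_of_det h (ψ z).coe_im_pos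
  have h3 := denom_ne_zero_of_det hdet z.coe_im_pos
  have e := (eq_div_iff h1).1 (hψ z)
  rw [Function.comp_apply, hφ, div_eq_div_iff h2 h3]
  push_cast
  linear_combination (p * s - r * q : ℂ) * e

/-- Pairs of points at the distance of `i` and `2 i` are images of `i` and `2 i` under a Möbius
transformation. -/
theorem exists_moebius_of_dist (a b a' b' : ℍ) (ha : (a : ℂ) = Complex.I)
    (hb : (b : ℂ) = 2 * Complex.I) (hd : dist a' b' = dist a b) :
    ∃ φ : ℍ ≃ᵢ ℍ, IsMoebius φ ∧ φ a = a' ∧ φ b = b' := by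
  have hare : a.re = 0 := by rw [← coe_re, ha]; simp
  have haim : a.im = 1 := by rw [← coe_im, ha]; simp
  have hbre : b.re = 0 := by rw [← coe_re, hb]; simp
  have hbim : b.im = 2 := by rw [← coe_im, hb]; simp
  have ha' := a'.im_pos
  have hs := Real.sqrt_pos.2 ha'
  have hss := Real.mul_self_sqrt ha'.le
  have hdet : √a'.im * (1 / √a'.im) - a'.re / √a'.im * 0 = 1 := by field_simp; simp
  obtain ⟨N, hN⟩ := exists_isometryEquiv_moebius _ _ _ _ hdet
  have hN' : ∀ z : ℍ, (N z : ℂ) = a'.im * z + a'.re := fun z => by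
    rw [hN]
    have : (√a'.im : ℂ) ≠ 0 := by exact_mod_cast hs.ne'
    have h2 : (√a'.im : ℂ) * √a'.im = a'.im := by exact_mod_cast hss
    push_cast
    field_simp
    rw [← h2]
    ring
  have hNa : N a = a' := by
    apply UpperHalfPlane.ext
    rw [hN', ha, ← re_add_im a']
    ring
  obtain ⟨w, hw⟩ : ∃ w, N w = b' := ⟨N.symm b', N.apply_symm_apply _⟩
  have hdw : dist a w = dist a b := by rw [← hd, ← hNa, ← hw, N.dist_eq]
  have hy := w.im_pos
  rw [dist_eq_dist_iff, hare, haim, hbre, hbim] at hdw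
  field_simp at hdw
  have hx2 : w.re ^ 2 = (2 - w.im) * (2 * w.im - 1) / 2 := by linarith
  have hpos : 0 ≤ (2 - w.im) * (2 * w.im - 1) := by nlinarith [sq_nonneg w.re]
  have hy2 : w.im ≤ 2 := by
    by_contra! h
    nlinarith
  have hy1 : 1 ≤ 2 * w.im := by
    by_contra! h
    nlinarith
  -- With `c`, `s` a cosine and a sine, these equations say that the rotation `(c z + s) / (-s z +
  -- c)` about `i` takes `2 i` to `w`.
  obtain ⟨c, s, hcs, hs2, hxx⟩ : ∃ c s : ℝ, c * c + s * s = 1 ∧ w.im * (1 + 3 * s ^ 2) = 2 ∧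
      w.re * (1 + 3 * s ^ 2) = -3 * c * s := by
    have hs0 : 0 ≤ (2 / w.im - 1) / 3 := by
      have : 1 ≤ 2 / w.im := by rw [le_div_iff₀ hy]; linarith
      linarith
    have hc0 : 0 ≤ 1 - (2 / w.im - 1) / 3 := by
      have : 2 / w.im ≤ 4 := by rw [div_le_iff₀ hy]; linarith
      linarith
    have e1 := Real.sq_sqrt hs0
    have e2 := Real.sq_sqrt hc0
    have e3 : w.im * (1 + 3 * √((2 / w.im - 1) / 3) ^ 2) = 2 := by
      rw [e1]; field_simp; ring
    have e4 : (w.re * (1 + 3 * √((2 / w.im - 1) / 3) ^ 2)) ^ 2 =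
        (3 * √(1 - (2 / w.im - 1) / 3) * √((2 / w.im - 1) / 3)) ^ 2 := by
      rw [mul_pow, mul_pow, mul_pow, e1, e2, hx2]
      field_simp
      ring
    rcases sq_eq_sq_iff_eq_or_eq_neg.1 e4 with h | h
    · exact ⟨-√(1 - (2 / w.im - 1) / 3), √((2 / w.im - 1) / 3), by linarith, e3, by linarith⟩
    · exact ⟨√(1 - (2 / w.im - 1) / 3), √((2 / w.im - 1) / 3), by linarith, e3, by linarith⟩
  have hdetR : c * c - s * (-s) = 1 := by linarith
  obtain ⟨R, hR⟩ := exists_isometryEquiv_moebius _ _ _ _ hdetR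
  have hRa : R a = a := by
    apply UpperHalfPlane.ext
    have h0 := denom_ne_zero_of_det hdetR a.coe_im_pos
    rw [hR, div_eq_iff h0, ha]
    push_cast
    linear_combination (s : ℂ) * Complex.I_sq
  have hRb : R b = w := by
    apply UpperHalfPlane.ext
    have h0 := denom_ne_zero_of_det hdetR b.coe_im_pos
    have hk : (1 + 3 * s ^ 2) ≠ 0 := by positivity
    rw [hR, div_eq_iff h0, hb]
    have e1 : s = w.re * c + 2 * w.im * s := by
      apply mul_right_cancel₀ hk
      linear_combination -2 * s * hs2 - c * hxx + 3 * s * hcs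
    have e2 : 2 * c = w.im * c - 2 * w.re * s := by
      apply mul_right_cancel₀ hk
      linear_combination - c * hs2 + 2 * s * hxx
    apply Complex.ext
    · simp; linarith
    · simp; linarith
  refine ⟨R.trans N, IsMoebius.comp (φ := N) (ψ := R) ⟨_, _, _, _, hdet, hN⟩ ⟨_, _, _, _, hdetR, hR⟩, ?_, ?_⟩
  · change N (R a) = a'
    rw [hRa, hNa]
  · change N (R b) = b'
    rw [hRb, hw]

/-- Every isometry of the hyperbolic plane is a Möbius transformation, possibly preceded by the
reflection in the imaginary axis. -/
theorem isometryEquiv_classification (φ : ℍ ≃ᵢ ℍ) :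
    IsMoebius φ ∨ ∃ ψ ρ : ℍ → ℍ, IsMoebius ψ ∧ (∀ z : ℍ, (ρ z : ℂ) = -conj (z : ℂ)) ∧
      φ = ψ ∘ ρ := by
  obtain ⟨a, ha⟩ : ∃ u : ℍ, (u : ℂ) = Complex.I := ⟨⟨Complex.I, by simp⟩, rfl⟩
  obtain ⟨b, hb⟩ : ∃ u : ℍ, (u : ℂ) = 2 * Complex.I := ⟨⟨2 * Complex.I, by simp⟩, rfl⟩
  obtain ⟨ψ, hψ, hψa, hψb⟩ := exists_moebius_of_dist a b (φ a) (φ b) ha hb (φ.dist_eq a b)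
  have hfac : ∀ z, φ z = ψ ((φ.trans ψ.symm) z) := fun z => (ψ.apply_symm_apply _).symm
  rcases eq_or_eq_neg_conj_of_fix (φ.trans ψ.symm) a b ha hb
    (by change ψ.symm (φ a) = a; rw [← hψa, ψ.symm_apply_apply])
    (by change ψ.symm (φ b) = b; rw [← hψb, ψ.symm_apply_apply]) with h | h
  · left
    have : (φ : ℍ → ℍ) = ψ := funext fun z => by rw [hfac, h]
    rwa [this]
  · exact Or.inr ⟨ψ, φ.trans ψ.symm, hψ, h, funext hfac⟩

/-! ### Geodesic curvature under isometries -/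

/-- The signed geodesic curvature at a point `x + i y` with `y` as given, of a curve with velocity
`v` and second derivative `a` there. -/
noncomputable def curvatureAt (y : ℝ) (v a : ℂ) : ℝ :=
  (inner ℝ (a + Complex.I * v ^ 2 / (y : ℂ)) (Complex.I * v) / y ^ 2) / (‖v‖ / y) ^ 3

theorem geodesicCurvature_eq {c : ℝ → ℍ} {v : ℝ → ℂ} {a : ℂ} {t : ℝ}
    (hv : ∀ t, HasDerivAt (coord c) (v t) t) (ha : HasDerivAt v a t) :
    geodesicCurvature c t = curvatureAt (c t).im (v t) a := by
  have h : deriv (coord c) = v := funext fun t => (hv t).deriv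
  unfold geodesicCurvature covAccel speed curvatureAt
  rw [h, ha.deriv]

/-- The factor `m` plays the role of the complex derivative of an isometry: it scales heights by its
modulus and multiplies velocity and covariant acceleration. No map is required, so `m` can also be
the point of the curve itself, which serves for the perturbed geodesics. -/
theorem curvatureAt_of_conformal {y y' : ℝ} {v a v' a' m : ℂ} (hm : m ≠ 0)
    (hy' : y' = ‖m‖ * y) (hv : v' = m * v)
    (ha : a' + Complex.I * v' ^ 2 / (y' : ℂ) = m * (a + Complex.I * v ^ 2 / (y : ℂ))) :
    curvatureAt y' v' a' = curvatureAt y v a := by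
  have hm' : ‖m‖ ≠ 0 := norm_ne_zero_iff.2 hm
  have hinner : ∀ w : ℂ, inner ℝ (m * w) (Complex.I * (m * v)) =
      ‖m‖ ^ 2 * inner ℝ w (Complex.I * v) := by
    intro w
    rw [← Complex.normSq_eq_norm_sq, Complex.inner, Complex.inner, ← Complex.re_ofReal_mul,
      Complex.normSq_eq_conj_mul_self]
    congr 1
    simp only [map_mul]
    ring
  unfold curvatureAt
  rw [ha, hv, hinner, hy', norm_mul, mul_div_mul_left _ _ hm', mul_pow,
    mul_div_mul_left _ _ (pow_ne_zero 2 hm')]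

theorem curvatureAt_neg_conj (y : ℝ) (v a : ℂ) :
    curvatureAt y (-conj v) (-conj a) = -1 * curvatureAt y v a := by
  have h : -conj a + Complex.I * (-conj v) ^ 2 / (y : ℂ) =
      -conj (a + Complex.I * v ^ 2 / (y : ℂ)) := by
    simp
    ring
  unfold curvatureAt
  rw [h, norm_neg, Complex.norm_conj, Complex.inner, Complex.inner]
  generalize a + Complex.I * v ^ 2 / (y : ℂ) = w
  have : (Complex.I * -conj v * conj (-conj w)).re = -(Complex.I * v * conj w).re := by
    simp
    ring
  rw [this]
  ring

theorem IsRegularCurve.hasDerivAt {c : ℝ → ℍ} (hc : IsRegularCurve c) (t : ℝ) :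
    HasDerivAt (coord c) (deriv (coord c) t) t :=
  (hc.1.differentiable (by simp)).differentiableAt.hasDerivAt

theorem IsRegularCurve.hasDerivAt_deriv {c : ℝ → ℍ} (hc : IsRegularCurve c) (t : ℝ) :
    HasDerivAt (deriv (coord c)) (deriv (deriv (coord c)) t) t :=
  ((hc.1.iterate_deriv 1).differentiable (by simp)).differentiableAt.hasDerivAt

theorem IsRegularCurve.continuous {c : ℝ → ℍ} (hc : IsRegularCurve c) : Continuous c :=
  isEmbedding_coe.continuous_iff.2 hc.1.continuous

/-- A map of `ℍ` that is smooth, preserves regular curves, and multiplies their geodesic curvature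
by a nonzero constant. -/
structure ScalesCurvature (φ : ℍ → ℍ) : Prop where
  contDiffOn : ContDiffOn ℝ ∞ (fun z : ℂ => (φ (ofComplex z) : ℂ)) {z | 0 < z.im}
  curvature : ∃ σ : ℝ, σ ≠ 0 ∧ ∀ c, IsRegularCurve c →
    IsRegularCurve (φ ∘ c) ∧ ∀ t, geodesicCurvature (φ ∘ c) t = σ * geodesicCurvature c t

theorem coord_comp (φ : ℍ → ℍ) (c : ℝ → ℍ) :
    coord (φ ∘ c) = (fun z : ℂ => (φ (ofComplex z) : ℂ)) ∘ coord c := by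
  funext t
  simp [coord, ofComplex_apply]

theorem contDiff_coord_comp {φ : ℍ → ℍ}
    (h : ContDiffOn ℝ ∞ (fun z : ℂ => (φ (ofComplex z) : ℂ)) {z | 0 < z.im}) {c : ℝ → ℍ}
    (hc : ContDiff ℝ ∞ (coord c)) : ContDiff ℝ ∞ (coord (φ ∘ c)) := by
  rw [coord_comp]
  exact h.comp_contDiff hc fun t => (c t).coe_im_pos

theorem ScalesCurvature.comp {φ ψ : ℍ → ℍ} (hφ : ScalesCurvature φ) (hψ : ScalesCurvature ψ) :
    ScalesCurvature (φ ∘ ψ) := by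
  constructor
  · refine (hφ.contDiffOn.comp hψ.contDiffOn fun z _ => (ψ (ofComplex z)).coe_im_pos).congr ?_
    intro z _
    simp [ofComplex_apply]
  · obtain ⟨σ, hσ, h⟩ := hφ.curvature
    obtain ⟨τ, hτ, h'⟩ := hψ.curvature
    refine ⟨σ * τ, mul_ne_zero hσ hτ, fun c hc => ?_⟩
    obtain ⟨h1, h2⟩ := h' c hc
    obtain ⟨h3, h4⟩ := h _ h1
    exact ⟨h3, fun t => by rw [Function.comp_assoc, h4, h2, mul_assoc]⟩

theorem scalesCurvature_neg_conj {ρ : ℍ → ℍ} (hρ : ∀ z : ℍ, (ρ z : ℂ) = -conj (z : ℂ)) :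
    ScalesCurvature ρ := by
  have hsm : ContDiffOn ℝ ∞ (fun z : ℂ => (ρ (ofComplex z) : ℂ)) {z | 0 < z.im} := by
    have : ContDiff ℝ ∞ fun z : ℂ => -conj z := Complex.conjCLE.contDiff.neg
    refine this.contDiffOn.congr fun z hz => ?_
    rw [hρ, ofComplex_apply_of_im_pos hz]
  refine ⟨hsm, -1, by norm_num, fun c hc => ?_⟩
  have hco : coord (ρ ∘ c) = fun t => -conj (coord c t) := funext fun t => hρ (c t)
  have hconj : ∀ {f : ℝ → ℂ} {f' : ℂ} {t : ℝ}, HasDerivAt f f' t →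
      HasDerivAt (fun t => -conj (f t)) (-conj f') t := fun h =>
    (Complex.conjCLE.toContinuousLinearMap.hasFDerivAt.comp_hasDerivAt _ h).neg
  have hv : ∀ t, HasDerivAt (coord (ρ ∘ c)) (-conj (deriv (coord c) t)) t := fun t => by
    rw [hco]; exact hconj (hc.hasDerivAt t)
  refine ⟨⟨contDiff_coord_comp hsm hc.1, fun t => ?_⟩, fun t => ?_⟩
  · rw [(hv t).deriv]
    simpa using hc.2 t
  · rw [geodesicCurvature_eq hv (hconj (hc.hasDerivAt_deriv t)),
      geodesicCurvature_eq hc.hasDerivAt (hc.hasDerivAt_deriv t), curvatureAt_neg_conj]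
    have : (ρ (c t)).im = (c t).im := by rw [← coe_im, hρ]; simp
    rw [Function.comp_apply, this]

theorem IsMoebius.scalesCurvature {φ : ℍ → ℍ} (hφ : IsMoebius φ) : ScalesCurvature φ := by
  obtain ⟨p, q, r, s, h, hφ⟩ := hφ
  have hsm : ContDiffOn ℝ ∞ (fun z : ℂ => (φ (ofComplex z) : ℂ)) {z | 0 < z.im} := by
    have : ContDiffOn ℂ ∞ (fun z : ℂ => (p * z + q : ℂ) / (r * z + s)) {z | 0 < z.im} :=
      ContDiffOn.div ((contDiff_const.mul contDiff_id).add contDiff_const).contDiffOn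
        ((contDiff_const.mul contDiff_id).add contDiff_const).contDiffOn
        fun z hz => denom_ne_zero_of_det h hz
    refine (this.restrict_scalars ℝ).congr fun z hz => ?_
    rw [hφ, ofComplex_apply_of_im_pos hz]
  refine ⟨hsm, 1, one_ne_zero, fun c hc => ?_⟩
  have hco : coord (φ ∘ c) = fun t => (p * coord c t + q) / (r * coord c t + s) :=
    funext fun t => hφ (c t)
  have hD : ∀ t, (r * coord c t + s : ℂ) ≠ 0 := fun t => denom_ne_zero_of_det h (c t).coe_im_pos
  have hdet : (p * s - q * r : ℂ) = 1 := by exact_mod_cast h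
  have hDd : ∀ t, HasDerivAt (fun t => (r * coord c t + s : ℂ)) (r * deriv (coord c) t) t :=
    fun t => ((hc.hasDerivAt t).const_mul _).add_const _
  have hv : ∀ t, HasDerivAt (coord (φ ∘ c)) (deriv (coord c) t / (r * coord c t + s) ^ 2) t := by
    intro t
    rw [hco]
    refine ((((hc.hasDerivAt t).const_mul (p : ℂ)).add_const (q : ℂ)).div (hDd t)
      (hD t)).congr_deriv ?_
    congr 1
    linear_combination (deriv (coord c) t) * hdet
  have ha : ∀ t, HasDerivAt (fun t => deriv (coord c) t / (r * coord c t + s) ^ 2)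
      (deriv (deriv (coord c)) t / (r * coord c t + s) ^ 2 -
        2 * r * deriv (coord c) t ^ 2 / (r * coord c t + s) ^ 3) t := by
    intro t
    have hDt := hD t
    refine ((hc.hasDerivAt_deriv t).div ((hDd t).pow 2) (pow_ne_zero 2 hDt)).congr_deriv ?_
    simp only [Pi.pow_apply]
    generalize (r * coord c t + s : ℂ) = D at *
    field_simp
    norm_num
    ring
  refine ⟨⟨contDiff_coord_comp hsm hc.1, fun t => ?_⟩, fun t => ?_⟩
  · rw [(hv t).deriv]
    exact div_ne_zero (hc.2 t) (pow_ne_zero 2 (hD t))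
  · have hDt := hD t
    have hy := (c t).im_pos
    have hyC : ((c t).im : ℂ) ≠ 0 := by exact_mod_cast hy.ne'
    have hnsq : Complex.normSq (r * coord c t + s) ≠ 0 := by simpa using hDt
    have him : ((φ ∘ c) t).im = (c t).im / Complex.normSq (r * coord c t + s) := by
      rw [Function.comp_apply, ← coe_im, hφ, Complex.div_im]
      change _ = (c t).im / Complex.normSq (r * (c t : ℂ) + s)
      simp
      rw [← sub_div]
      congr 1
      linear_combination (c t).im * h
    rw [one_mul, geodesicCurvature_eq hv (ha t),
      geodesicCurvature_eq hc.hasDerivAt (hc.hasDerivAt_deriv t)]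
    refine curvatureAt_of_conformal (m := 1 / (r * coord c t + s) ^ 2)
      (one_div_ne_zero (pow_ne_zero 2 hDt)) ?_ (by ring) ?_
    · rw [him, norm_div, norm_one, norm_pow, ← Complex.normSq_eq_norm_sq]
      ring
    · rw [him]
      -- The correction `-2 r y i` makes the Christoffel term cancel the extra term in the second
      -- derivative of the image.
      have hconj : conj (r * coord c t + s : ℂ) =
          r * coord c t + s - 2 * r * (c t).im * Complex.I := by
        apply Complex.ext
        · simp [coord]
        · simp [coord]
          ring
      have hcne : conj (r * coord c t + s : ℂ) ≠ 0 := (map_ne_zero _).2 hDt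
      push_cast
      rw [← Complex.mul_conj]
      rw [hconj] at hcne ⊢
      generalize (r * coord c t + s : ℂ) = D at *
      generalize ((c t).im : ℂ) = y at *
      field_simp
      linear_combination (-2 * r * y * deriv (coord c) t ^ 2) * Complex.I_sq

theorem scalesCurvature_isometryEquiv (φ : ℍ ≃ᵢ ℍ) : ScalesCurvature φ := by
  rcases isometryEquiv_classification φ with h | ⟨ψ, ρ, hψ, hρ, h⟩
  · exact h.scalesCurvature
  · rw [h]
    exact hψ.scalesCurvature.comp (scalesCurvature_neg_conj hρ)

/-! ### From equivariant families to closed curves -/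

/-- Two curves with the same projection differ by an element of the group. -/
theorem exists_mem_apply_eq_of_proj_eq {G : Subgroup (ℍ ≃ᵢ ℍ)} (hG : IsSurfaceGroup G)
    {c c' : ℝ → ℍ} (hc : Continuous c) (hc' : Continuous c')
    (h : ∀ t, proj G (c t) = proj G (c' t)) : ∃ g ∈ G, ∀ t, g (c t) = c' t := by
  have hex : ∀ t, ∃ g ∈ G, g (c t) = c' t := fun t => Quotient.exact (h t)
  obtain ⟨g, hg, hg0⟩ := hex 0
  refine ⟨g, hg, ?_⟩
  have hgc : Continuous fun t => g (c t) := g.continuous.comp hc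
  suffices hcl : IsClopen {t | g (c t) = c' t} by
    have := hcl.eq_univ ⟨0, hg0⟩
    exact fun t => (this ▸ Set.mem_univ t : t ∈ {t | g (c t) = c' t})
  refine ⟨isClosed_eq hgc hc', isOpen_iff_mem_nhds.2 fun t₀ ht₀ => ?_⟩
  have ht₀ : g (c t₀) = c' t₀ := ht₀
  have hK := hG.properlyDiscontinuous _ (isCompact_closedBall (c' t₀) 1)
  -- Proper discontinuity leaves finitely many competitors `f` near `t₀`; by freeness each `f ≠ 1`
  -- moves `c' t₀`, hence fails to match the two curves nearby.
  have hne : ∀ᶠ t in 𝓝 t₀, ∀ f ∈ {f : ℍ ≃ᵢ ℍ | f ∈ G ∧ (f '' Metric.closedBall (c' t₀) 1 ∩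
      Metric.closedBall (c' t₀) 1).Nonempty}, f ≠ 1 → f (g (c t)) ≠ c' t := by
    rw [eventually_all_finite hK]
    intro f hf
    by_cases hf1 : f = 1
    · simp [hf1]
    · have : f (g (c t₀)) ≠ c' t₀ := fun hfix => hf1 (hG.free f hf.1 _ (by rwa [ht₀] at hfix))
      filter_upwards [(isOpen_ne_fun (f.continuous.comp hgc) hc').mem_nhds this] with t ht _
        using ht
  have h1 : ∀ᶠ t in 𝓝 t₀, c' t ∈ Metric.closedBall (c' t₀) 1 :=
    hc'.continuousAt (Metric.closedBall_mem_nhds _ one_pos)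
  have h2 : ∀ᶠ t in 𝓝 t₀, g (c t) ∈ Metric.closedBall (c' t₀) 1 := by
    rw [← ht₀]
    exact hgc.continuousAt (Metric.closedBall_mem_nhds _ one_pos)
  filter_upwards [hne, h1, h2] with t hne h1 h2
  obtain ⟨f, hf, hft⟩ := hex t
  have hfg : (f * g⁻¹) (g (c t)) = c' t := by
    rw [← hft]
    exact congrArg f (g.symm_apply_apply _)
  by_contra hcon
  refine hne (f * g⁻¹) ⟨G.mul_mem hf (G.inv_mem hg), c' t, ⟨_, h2, hfg⟩, h1⟩ ?_ hfg
  intro h1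
  rw [h1] at hfg
  exact hcon hfg

/-- Each derivative of a slice is the total derivative applied to the direction `(0, 1)`. -/
theorem contDiffOn_iteratedDeriv_slice {U : Set (ℝ × ℝ)} (hU : IsOpen U) {H : ℝ → ℝ → ℂ}
    (hH : ContDiffOn ℝ ∞ (fun p : ℝ × ℝ => H p.1 p.2) U) (j : ℕ) :
    ContDiffOn ℝ ∞ (fun p : ℝ × ℝ => iteratedDeriv j (H p.1) p.2) U := by
  induction j with
  | zero => simpa using hH
  | succ n ih =>
    have h1 := (ih.fderiv_of_isOpen hU (m := ∞) (by simp)).clm_apply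
      (contDiffOn_const (c := ((0 : ℝ), (1 : ℝ))))
    refine h1.congr fun p hp => ?_
    rw [iteratedDeriv_succ]
    have hd := ((ih.contDiffAt (hU.mem_nhds hp)).differentiableAt (by simp)).hasFDerivAt
    have hline : HasDerivAt (fun t : ℝ => (p.1, t)) ((0 : ℝ), (1 : ℝ)) p.2 :=
      (hasDerivAt_const _ _).prodMk (hasDerivAt_id _)
    exact (hd.comp_hasDerivAt p.2 hline).deriv

/-- The difference is jointly continuous near `l = 0` and vanishes there; compactness of `[0, L]`
makes the bound uniform. -/
theorem eventually_iteratedDeriv_close {U : Set (ℝ × ℝ)} (hU : IsOpen U) {H : ℝ → ℝ → ℂ}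
    (hH : ContDiffOn ℝ ∞ (fun p : ℝ × ℝ => H p.1 p.2) U) (h0 : ∀ t, ((0 : ℝ), t) ∈ U)
    (k : ℕ) (L : ℝ) {ε : ℝ} (hε : 0 < ε) :
    ∀ᶠ l in 𝓝 (0 : ℝ), ∀ j ≤ k, ∀ t ∈ Set.Icc 0 L,
      ‖iteratedDeriv j (H l) t - iteratedDeriv j (H 0) t‖ < ε := by
  have : ∀ᶠ l in 𝓝 (0 : ℝ), ∀ j ∈ Set.Iic k, ∀ t ∈ Set.Icc 0 L,
      ‖iteratedDeriv j (H l) t - iteratedDeriv j (H 0) t‖ < ε := by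
    rw [eventually_all_finite (Set.finite_Iic k)]
    intro j _
    refine isCompact_Icc.eventually_forall_of_forall_eventually fun t _ => ?_
    have hcont := (contDiffOn_iteratedDeriv_slice hU hH j).continuousOn.continuousAt
      (hU.mem_nhds (h0 t))
    have hmap : ContinuousAt (fun p : ℝ × ℝ => ((0 : ℝ), p.2)) (0, t) := by fun_prop
    have hcont2 : ContinuousAt (fun p : ℝ × ℝ => iteratedDeriv j (H 0) p.2) (0, t) :=
      ContinuousAt.comp (f := fun p : ℝ × ℝ => ((0 : ℝ), p.2))
        (g := fun p : ℝ × ℝ => iteratedDeriv j (H p.1) p.2) hcont hmap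
    refine (hcont.sub hcont2).norm.eventually_lt continuousAt_const ?_
    simpa using hε
  exact this

theorem eventually_abs_lt_one : ∀ᶠ l in 𝓝 (0 : ℝ), |l| < 1 := by
  have : ContinuousAt (fun l : ℝ => |l|) 0 := continuous_abs.continuousAt
  exact this.eventually_lt continuousAt_const (by simp)

/-- Suppose that an isometry `A` takes `c` to the first curve of a smooth family of regular curves
on each of which `A g A⁻¹` acts as the translation of the parameter by `L`, and that the other
curves of the family have vertices only at multiples of `L / 2`. Then `c` is close to a lift of a
closed curve with at most two vertices. -/
theorem exists_close_of_family {G : Subgroup (ℍ ≃ᵢ ℍ)} (hG : IsSurfaceGroup G)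
    (L : ℝ) (c : ℝ → ℍ) (k : ℕ) {ε : ℝ} (hε : 0 < ε) {g : ℍ ≃ᵢ ℍ} (hg : g ∈ G) (A : ℍ ≃ᵢ ℍ)
    (B : ℝ → ℝ → ℂ)
    (hB : ContDiff ℝ ∞ fun p : ℝ × ℝ => B p.1 p.2)
    (hpos : ∀ l, |l| < 1 → ∀ t, 0 < (B l t).im)
    (hreg : ∀ l, |l| < 1 → ∀ t, deriv (B l) t ≠ 0)
    (h0 : ∀ t, (A (c t) : ℂ) = B 0 t)
    (hequiv : ∀ l, |l| < 1 → ∀ t, (A (g (A.symm (ofComplex (B l t)))) : ℂ) = B l (t + L))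
    (hvert : ∀ᶠ l in 𝓝[≠] (0 : ℝ), ∀ t,
      deriv (geodesicCurvature fun t => ofComplex (B l t)) t = 0 → ∃ n : ℤ, t = n * (L / 2)) :
    ∃ γ' : AddCircle L → Surface G, IsClosedCurve G γ' ∧ γ' ∈ smoothNhd G L c k ε ∧
      {τ : AddCircle L | IsVertex G γ' τ}.encard ≤ 2 := by
  have hA := scalesCurvature_isometryEquiv A.symm
  set H : ℝ → ℝ → ℂ := fun l t => (A.symm (ofComplex (B l t)) : ℂ) with hHdef
  have hU : IsOpen {p : ℝ × ℝ | 0 < (B p.1 p.2).im} :=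
    isOpen_lt continuous_const (Complex.continuous_im.comp hB.continuous)
  have hH : ContDiffOn ℝ ∞ (fun p : ℝ × ℝ => H p.1 p.2) {p : ℝ × ℝ | 0 < (B p.1 p.2).im} :=
    hA.contDiffOn.comp hB.contDiffOn fun p hp => hp
  have hHc : H 0 = coord c := by
    funext t
    rw [hHdef]
    simp only [← h0, ofComplex_apply, A.symm_apply_apply]
    rfl
  have hclose := eventually_iteratedDeriv_close hU hH (fun t => hpos 0 (by simp) t) k L hε
  -- `hvert` omits `l = 0`, where in the applications the curvature is constant.
  obtain ⟨l, ⟨hl1, hl2⟩, hl3⟩ :=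
    (((hclose.and eventually_abs_lt_one).filter_mono nhdsWithin_le_nhds).and hvert).exists
  set b : ℝ → ℍ := fun t => ofComplex (B l t) with hb
  have hbcoord : coord b = B l := by
    funext t
    simp only [coord, hb, ofComplex_apply_of_im_pos (hpos l hl2 t)]
  have hbreg : IsRegularCurve b := by
    refine ⟨?_, fun t => ?_⟩
    · rw [hbcoord]
      exact hB.comp (contDiff_const.prodMk contDiff_id)
    · rw [hbcoord]
      exact hreg l hl2 t
  obtain ⟨σ, hσ, hcurv⟩ := hA.curvature
  obtain ⟨hcreg, hcc⟩ := hcurv b hbreg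
  set c' : ℝ → ℍ := A.symm ∘ b with hc'
  have hper : Function.Periodic (fun t => proj G (c' t)) L := by
    intro t
    have : g (c' t) = c' (t + L) := by
      apply A.injective
      apply UpperHalfPlane.ext
      rw [hc', Function.comp_apply, Function.comp_apply, A.apply_symm_apply,
        hequiv l hl2 t]
      exact (congrFun hbcoord (t + L)).symm
    exact (Quotient.sound (s := orbitSetoid G) ⟨g, hg, this⟩).symm
  have hlift : IsLift G (hper.lift : AddCircle L → Surface G) c' :=
    ⟨hcreg, fun t => (hper.lift_coe t).symm⟩
  refine ⟨hper.lift, ⟨c', hlift⟩, ⟨c', hlift, fun j hj t ht => ?_⟩, ?_⟩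
  · rw [← hHc]
    exact hl1 j hj t ht
  · have hsub : {τ : AddCircle L | IsVertex G (hper.lift : AddCircle L → Surface G) τ} ⊆
        {((0 : ℝ) : AddCircle L), ((L / 2 : ℝ) : AddCircle L)} := by
      rintro τ ⟨c₂, hc₂, t, rfl, ht⟩
      -- The lift witnessing the vertex is a translate of `c'` by `f ∈ G`, so its curvature has the
      -- same critical points.
      obtain ⟨f, hf, hfc⟩ := exists_mem_apply_eq_of_proj_eq hG hcreg.continuous
        hc₂.1.continuous (fun t => by rw [hlift.2, hc₂.2])
      have hfc' : c₂ = f ∘ c' := funext fun t => (hfc t).symm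
      obtain ⟨σ', hσ', hcurv'⟩ := (scalesCurvature_isometryEquiv f).curvature
      have hk : geodesicCurvature c₂ = fun t => σ' * σ * geodesicCurvature b t := by
        funext t
        rw [hfc', (hcurv' c' hcreg).2 t, hcc t, mul_assoc]
      rw [hk, deriv_const_mul_field] at ht
      obtain ⟨n, rfl⟩ := hl3 t ((mul_eq_zero.1 ht).resolve_left (mul_ne_zero hσ' hσ))
      rcases Int.even_or_odd' n with ⟨m, rfl | rfl⟩
      · left
        have : ((2 * m : ℤ) : ℝ) * (L / 2) = 0 + m • L := by push_cast; rw [zsmul_eq_mul]; ring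
        rw [this, AddCircle.coe_add, AddCircle.coe_zsmul, AddCircle.coe_period, smul_zero, add_zero]
      · right
        have : ((2 * m + 1 : ℤ) : ℝ) * (L / 2) = L / 2 + m • L := by
          push_cast; rw [zsmul_eq_mul]; ring
        rw [this, AddCircle.coe_add, AddCircle.coe_zsmul, AddCircle.coe_period, smul_zero, add_zero]
        rfl
    refine (Set.encard_le_encard hsub).trans ((Set.encard_insert_le _ _).trans ?_)
    rw [Set.encard_singleton, one_add_one_eq_two]

/-! ### Curvature as a function of the cosine -/

/-- The chain rule gives `-w sin (w t)` times `(N' Q - 3/2 N Q') / Q ^ (5/2)`; `hne` excludes the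
second factor. -/
theorem sin_eq_zero_of_deriv_eq_zero {N Q : ℝ → ℝ} {N' Q' w t : ℝ} (hw : w ≠ 0)
    (hN : HasDerivAt N N' (Real.cos (w * t))) (hQ : HasDerivAt Q Q' (Real.cos (w * t)))
    (hQ0 : 0 < Q (Real.cos (w * t)))
    (hne : N' * Q (Real.cos (w * t)) - 3 / 2 * N (Real.cos (w * t)) * Q' ≠ 0)
    (hd : deriv (fun t => N (Real.cos (w * t)) / √(Q (Real.cos (w * t))) ^ 3) t = 0) :
    Real.sin (w * t) = 0 := by
  have hs := Real.sqrt_pos.2 hQ0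
  have hss := Real.sq_sqrt hQ0.le
  have hcos : HasDerivAt (fun t => Real.cos (w * t)) (-Real.sin (w * t) * w) t := by
    simpa using ((hasDerivAt_id t).const_mul w).cos
  have hF : HasDerivAt (fun x => N x / √(Q x) ^ 3)
      ((N' * Q (Real.cos (w * t)) - 3 / 2 * N (Real.cos (w * t)) * Q') /
        √(Q (Real.cos (w * t))) ^ 5) (Real.cos (w * t)) := by
    refine (hN.div ((hQ.sqrt hQ0.ne').pow 3) (pow_ne_zero 3 hs.ne')).congr_deriv ?_
    simp only [Pi.pow_apply]
    rw [← hss]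
    generalize √(Q (Real.cos (w * t))) = S at *
    rw [Real.sqrt_sq hs.le]
    field_simp
    norm_num
    ring
  have hcomp := hF.comp t hcos
  have hd' : deriv (fun t => N (Real.cos (w * t)) / √(Q (Real.cos (w * t))) ^ 3) t = _ :=
    hcomp.deriv
  rw [hd'] at hd
  rcases mul_eq_zero.1 hd with h | h
  · exact absurd h (div_ne_zero hne (pow_ne_zero 5 hs.ne'))
  · exact neg_eq_zero.1 ((mul_eq_zero.1 h).resolve_right hw)

/-- The `e` term has the shape of the Christoffel term `i v² / y` and merely replaces `1 / y` by `e
+ 1 / y`. Horocycles use `e = 0`; geodesics need `e` for the change to logarithmic coordinates. -/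
theorem curvatureAt_graph {y : ℝ} (hy : 0 < y) (b e p : ℝ) :
    curvatureAt y (1 + Complex.I * p) (Complex.I * b + Complex.I * e * (1 + Complex.I * p) ^ 2) =
      (y * b + (y * e + 1) * (1 + p ^ 2)) / √(1 + p ^ 2) ^ 3 := by
  have hn : ‖(1 + Complex.I * p : ℂ)‖ = √(1 + p ^ 2) := by
    rw [Complex.norm_def, Complex.normSq_apply]
    simp
    ring_nf
  have hacc : Complex.I * b + Complex.I * e * (1 + Complex.I * p) ^ 2 +
      Complex.I * (1 + Complex.I * p) ^ 2 / (y : ℂ) =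
      Complex.I * ((b : ℂ) + ((e + 1 / y : ℝ) : ℂ) * (1 + Complex.I * p) ^ 2) := by
    push_cast
    ring
  have hs : 0 < √(1 + p ^ 2) := Real.sqrt_pos.2 (by positivity)
  unfold curvatureAt
  rw [hn, hacc, Complex.inner]
  have hre : ∀ f : ℝ, (Complex.I * (1 + Complex.I * p) *
      conj (Complex.I * ((b : ℂ) + (f : ℂ) * (1 + Complex.I * p) ^ 2))).re =
      b + f * (1 + p ^ 2) := by
    intro f
    have : Complex.I * (1 + Complex.I * p) *
        conj (Complex.I * ((b : ℂ) + (f : ℂ) * (1 + Complex.I * p) ^ 2)) =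
        ((b + f * (1 + p ^ 2) : ℝ) : ℂ) +
          ((p * b - f * (1 + p ^ 2) * p : ℝ) : ℂ) * Complex.I := by
      simp only [map_mul, map_add, map_pow, map_one, Complex.conj_I, Complex.conj_ofReal]
      push_cast
      linear_combination (-((1 + Complex.I * p) * (b + f * (1 - Complex.I * p) ^ 2)) -
        f * p ^ 2 * (1 - Complex.I * p)) * Complex.I_sq
    rw [this, Complex.add_re, Complex.re_ofReal_mul, Complex.ofReal_re, Complex.I_re, mul_zero,
      add_zero]
  rw [hre]
  field_simp

theorem one_add_I_mul_ofReal_ne_zero (p : ℝ) : (1 + Complex.I * p : ℂ) ≠ 0 := fun h0 => by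
  have := congrArg Complex.re h0
  simp [-Complex.ofReal_mul, -Complex.ofReal_neg, -Complex.ofReal_sin] at this

/-- Compactness of the range `[-1, 1]` of the cosine makes the choice of `l` independent of `t`. -/
theorem eventually_forall_ne_zero {g : ℝ → ℝ → ℝ} (hg : Continuous fun p : ℝ × ℝ => g p.1 p.2)
    (h0 : ∀ x, g 0 x ≠ 0) : ∀ᶠ l in 𝓝 (0 : ℝ), ∀ x ∈ Set.Icc (-1 : ℝ) 1, g l x ≠ 0 :=
  isCompact_Icc.eventually_forall_of_forall_eventually fun x _ =>
    hg.continuousAt.eventually_ne (h0 x)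

theorem cos_mem_Icc_neg_one_one (x : ℝ) : Real.cos x ∈ Set.Icc (-1 : ℝ) 1 :=
  ⟨Real.neg_one_le_cos x, Real.cos_le_one x⟩

theorem hasDerivAt_perturbation (l w t : ℝ) :
    HasDerivAt (fun t => l * Real.cos (w * t)) (-(l * w) * Real.sin (w * t)) t := by
  have := (((hasDerivAt_id t).const_mul w).cos.const_mul l)
  refine this.congr_deriv ?_
  simp
  ring

theorem hasDerivAt_deriv_perturbation (l w t : ℝ) :
    HasDerivAt (fun t => -(l * w) * Real.sin (w * t)) (-(l * w ^ 2) * Real.cos (w * t)) t := by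
  have := (((hasDerivAt_id t).const_mul w).sin.const_mul (-(l * w)))
  refine this.congr_deriv ?_
  simp
  ring

theorem hasDerivAt_speed_sq (a x : ℝ) :
    HasDerivAt (fun x : ℝ => 1 + a ^ 2 * (1 - x ^ 2)) (-2 * a ^ 2 * x) x := by
  have := (((hasDerivAt_id x).pow 2).const_sub 1).const_mul (a ^ 2) |>.const_add 1
  refine this.congr_deriv ?_
  simp
  ring

theorem speed_sq_pos (a x : ℝ) : 0 < 1 + a ^ 2 * (1 - Real.cos x ^ 2) := by
  rw [← Real.sin_sq]
  positivity

/-! ### Perturbed horocycles -/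

/-- The perturbation of the horocycle `t + i h` by a cosine wave. -/
noncomputable def horoFamily (h w l t : ℝ) : ℂ :=
  t + Complex.I * ((h * (1 + l * Real.cos (w * t)) : ℝ) : ℂ)

theorem contDiff_horoFamily (h w : ℝ) :
    ContDiff ℝ ∞ fun p : ℝ × ℝ => horoFamily h w p.1 p.2 := by
  unfold horoFamily
  have h1 : ContDiff ℝ ∞ fun p : ℝ × ℝ => h * (1 + p.1 * Real.cos (w * p.2)) := by fun_prop
  exact (Complex.ofRealCLM.contDiff.comp contDiff_snd).add
    (contDiff_const.mul (Complex.ofRealCLM.contDiff.comp h1))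

theorem abs_mul_cos_lt_one {l : ℝ} (hl : |l| < 1) (x : ℝ) : |l * Real.cos x| < 1 := by
  rw [abs_mul]
  exact (mul_le_of_le_one_right (abs_nonneg l) (Real.abs_cos_le_one x)).trans_lt hl

theorem horoFamily_im (h w l t : ℝ) :
    (horoFamily h w l t).im = h * (1 + l * Real.cos (w * t)) := by
  rw [horoFamily, Complex.add_im, Complex.I_mul_im, Complex.ofReal_im, Complex.ofReal_re, zero_add]

theorem horoFamily_im_pos {h : ℝ} (hh : 0 < h) (w : ℝ) {l : ℝ} (hl : |l| < 1) (t : ℝ) :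
    0 < (horoFamily h w l t).im := by
  rw [horoFamily_im]
  have := (abs_lt.1 (abs_mul_cos_lt_one hl (w * t))).1
  exact mul_pos hh (by linarith)

theorem hasDerivAt_horoFamily (h w l t : ℝ) :
    HasDerivAt (horoFamily h w l)
      (1 + Complex.I * ((h * (-(l * w) * Real.sin (w * t)) : ℝ) : ℂ)) t :=
  (hasDerivAt_id t).ofReal_comp.add
    ((((hasDerivAt_perturbation l w t).const_add 1).const_mul h).ofReal_comp.const_mul Complex.I)

theorem deriv_horoFamily_ne_zero (h w l t : ℝ) : deriv (horoFamily h w l) t ≠ 0 := by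
  rw [(hasDerivAt_horoFamily h w l t).deriv]
  exact one_add_I_mul_ofReal_ne_zero _

theorem geodesicCurvature_horoFamily {h : ℝ} (hh : 0 < h) (w : ℝ) {l : ℝ} (hl : |l| < 1) (t : ℝ) :
    geodesicCurvature (fun t => ofComplex (horoFamily h w l t)) t =
      (h ^ 2 * (1 + l * Real.cos (w * t)) * (-(l * w ^ 2) * Real.cos (w * t)) +
        (1 + (h * l * w) ^ 2 * (1 - Real.cos (w * t) ^ 2))) /
      √(1 + (h * l * w) ^ 2 * (1 - Real.cos (w * t) ^ 2)) ^ 3 := by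
  have hco : coord (fun t => ofComplex (horoFamily h w l t)) = horoFamily h w l := by
    funext t
    simp only [coord, ofComplex_apply_of_im_pos (horoFamily_im_pos hh w hl t)]
  have hi : (ofComplex (horoFamily h w l t) : ℍ).im = h * (1 + l * Real.cos (w * t)) := by
    rw [ofComplex_apply_of_im_pos (horoFamily_im_pos hh w hl t), ← horoFamily_im]; rfl
  have hpos := horoFamily_im_pos hh w hl t
  rw [horoFamily_im] at hpos
  have hv2 := (((hasDerivAt_deriv_perturbation l w t).const_mul h).ofReal_comp.const_mul
    Complex.I).const_add 1
  rw [geodesicCurvature_eq (fun t => by rw [hco]; exact hasDerivAt_horoFamily h w l t) hv2, hi]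
  have hg := curvatureAt_graph hpos (h * (-(l * w ^ 2) * Real.cos (w * t))) 0
    (h * (-(l * w) * Real.sin (w * t)))
  rw [Complex.ofReal_zero, mul_zero, zero_mul, add_zero] at hg
  have hsq : 1 + (h * (-(l * w) * Real.sin (w * t))) ^ 2 =
      1 + (h * l * w) ^ 2 * (1 - Real.cos (w * t) ^ 2) := by
    rw [← Real.sin_sq]; ring
  rw [hg, hsq]
  ring

theorem eventually_sin_eq_zero_of_vertex_horoFamily {h w : ℝ} (hh : 0 < h) (hw : w ≠ 0) :
    ∀ᶠ l in 𝓝[≠] (0 : ℝ), ∀ t,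
      deriv (geodesicCurvature fun t => ofComplex (horoFamily h w l t)) t = 0 →
      Real.sin (w * t) = 0 := by
  -- This is `(N' Q - 3/2 N Q') / l` for the curvature `N / Q ^ (3/2)`; at `l = 0` it equals `-h²
  -- w²`.
  have hne := eventually_forall_ne_zero (g := fun l x =>
    (-h ^ 2 * w ^ 2 - 4 * h ^ 2 * l * w ^ 2 * x) * (1 + (h * l * w) ^ 2 * (1 - x ^ 2)) +
      3 * h ^ 2 * l * w ^ 2 * x * (h ^ 2 * (1 + l * x) * (-(l * w ^ 2) * x) +
        (1 + (h * l * w) ^ 2 * (1 - x ^ 2)))) (by fun_prop)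
    (fun x => by simp [hh.ne', hw])
  filter_upwards [nhdsWithin_le_nhds hne, nhdsWithin_le_nhds eventually_abs_lt_one,
    self_mem_nhdsWithin] with l hl hl1 hl0 t ht
  rw [funext (geodesicCurvature_horoFamily hh w hl1)] at ht
  have hQ := hasDerivAt_speed_sq (h * l * w) (Real.cos (w * t))
  have hid := hasDerivAt_id (Real.cos (w * t))
  have hN := ((((hid.const_mul l).const_add 1).const_mul (h ^ 2)).mul
    (hid.const_mul (-(l * w ^ 2)))).add hQ
  refine sin_eq_zero_of_deriv_eq_zero hw hN hQ (speed_sq_pos _ _) ?_ ht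
  convert mul_ne_zero hl0 (hl _ (cos_mem_Icc_neg_one_one (w * t))) using 1
  simp
  ring

/-! ### Perturbed geodesics -/

/-- The perturbation of the geodesic `i exp t` by a cosine wave. -/
noncomputable def geodFamily (w l t : ℝ) : ℂ :=
  Complex.I * Complex.exp (t + Complex.I * ((l * Real.cos (w * t) : ℝ) : ℂ))

theorem contDiff_geodFamily (w : ℝ) : ContDiff ℝ ∞ fun p : ℝ × ℝ => geodFamily w p.1 p.2 := by
  unfold geodFamily
  have h1 : ContDiff ℝ ∞ fun p : ℝ × ℝ => p.1 * Real.cos (w * p.2) := by fun_prop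
  exact contDiff_const.mul ((Complex.ofRealCLM.contDiff.comp contDiff_snd).add
    (contDiff_const.mul (Complex.ofRealCLM.contDiff.comp h1))).cexp

theorem geodFamily_eq (w l t : ℝ) : geodFamily w l t =
    Complex.I * ((Real.exp t : ℝ) : ℂ) * (((Real.cos (l * Real.cos (w * t)) : ℝ) : ℂ) +
      ((Real.sin (l * Real.cos (w * t)) : ℝ) : ℂ) * Complex.I) := by
  rw [geodFamily, Complex.exp_add, mul_comm Complex.I ((l * Real.cos (w * t) : ℝ) : ℂ),
    Complex.exp_mul_I, Complex.ofReal_exp, Complex.ofReal_cos (l * _), Complex.ofReal_sin, mul_assoc]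

theorem geodFamily_im (w l t : ℝ) :
    (geodFamily w l t).im = Real.exp t * Real.cos (l * Real.cos (w * t)) := by
  rw [geodFamily_eq]
  simp [-Complex.ofReal_exp, -Complex.ofReal_cos, -Complex.ofReal_sin]

theorem cos_perturbation_pos (w : ℝ) {l : ℝ} (hl : |l| < 1) (t : ℝ) :
    0 < Real.cos (l * Real.cos (w * t)) := by
  have := abs_lt.1 (abs_mul_cos_lt_one hl (w * t))
  have := Real.pi_gt_three
  exact Real.cos_pos_of_mem_Ioo ⟨by linarith, by linarith⟩

theorem geodFamily_im_pos (w : ℝ) {l : ℝ} (hl : |l| < 1) (t : ℝ) :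
    0 < (geodFamily w l t).im := by
  rw [geodFamily_im]
  exact mul_pos (Real.exp_pos t) (cos_perturbation_pos w hl t)

theorem hasDerivAt_geodFamily (w l t : ℝ) : HasDerivAt (geodFamily w l)
    (geodFamily w l t * (1 + Complex.I * ((-(l * w) * Real.sin (w * t) : ℝ) : ℂ))) t := by
  have h := ((hasDerivAt_id t).ofReal_comp.add
    ((hasDerivAt_perturbation l w t).ofReal_comp.const_mul Complex.I)).cexp.const_mul Complex.I
  refine h.congr_deriv ?_
  rw [geodFamily, mul_assoc]
  rfl

theorem deriv_geodFamily_ne_zero (w l t : ℝ) : deriv (geodFamily w l) t ≠ 0 := by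
  rw [(hasDerivAt_geodFamily w l t).deriv]
  exact mul_ne_zero (mul_ne_zero Complex.I_ne_zero (Complex.exp_ne_zero _))
    (one_add_I_mul_ofReal_ne_zero _)

theorem norm_geodFamily (w l t : ℝ) : ‖geodFamily w l t‖ = Real.exp t := by
  rw [geodFamily, norm_mul, Complex.norm_I, one_mul, Complex.norm_exp, Complex.add_re, Complex.I_mul_re,
    Complex.ofReal_re, Complex.ofReal_im, neg_zero, add_zero]

/-- In the coordinate `ζ` with `z = i exp ζ` the metric is `|dζ|² / cos² (Im ζ)`, invariant under
real translations, and the curve is the graph of `l cos (w t)`. Hence `exp t` drops out. -/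
theorem geodesicCurvature_geodFamily (w : ℝ) {l : ℝ} (hl : |l| < 1) (t : ℝ) :
    geodesicCurvature (fun t => ofComplex (geodFamily w l t)) t =
      (Real.cos (l * Real.cos (w * t)) * (-(l * w ^ 2) * Real.cos (w * t)) -
        Real.sin (l * Real.cos (w * t)) * (1 + (l * w) ^ 2 * (1 - Real.cos (w * t) ^ 2))) /
      √(1 + (l * w) ^ 2 * (1 - Real.cos (w * t) ^ 2)) ^ 3 := by
  have hco : coord (fun t => ofComplex (geodFamily w l t)) = geodFamily w l := by
    funext t
    simp only [coord, ofComplex_apply_of_im_pos (geodFamily_im_pos w hl t)]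
  have hi : (ofComplex (geodFamily w l t) : ℍ).im =
      Real.exp t * Real.cos (l * Real.cos (w * t)) := by
    rw [ofComplex_apply_of_im_pos (geodFamily_im_pos w hl t), ← geodFamily_im]; rfl
  have hcos := cos_perturbation_pos w hl t
  have hv2 : HasDerivAt (fun t => geodFamily w l t *
      (1 + Complex.I * ((-(l * w) * Real.sin (w * t) : ℝ) : ℂ))) _ t :=
    (hasDerivAt_geodFamily w l t).mul
    (((hasDerivAt_deriv_perturbation l w t).ofReal_comp.const_mul Complex.I).const_add 1)
  rw [geodesicCurvature_eq (fun t => by rw [hco]; exact hasDerivAt_geodFamily w l t) hv2, hi]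
  -- With `θ = l cos (w t)`, this `e` gives `e + 1 / cos θ = -tan θ`, the Christoffel coefficient in
  -- the coordinate `ζ`; `key` below checks it.
  have hg := curvatureAt_graph hcos (-(l * w ^ 2) * Real.cos (w * t))
    (-(Real.sin (l * Real.cos (w * t)) + 1) / Real.cos (l * Real.cos (w * t)))
    (-(l * w) * Real.sin (w * t))
  have hsq : 1 + (-(l * w) * Real.sin (w * t)) ^ 2 =
      1 + (l * w) ^ 2 * (1 - Real.cos (w * t) ^ 2) := by
    rw [← Real.sin_sq]; ring
  rw [curvatureAt_of_conformal (m := geodFamily w l t) ?_ ?_ rfl ?_, hg, hsq]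
  · congr 1
    field_simp
    ring
  · exact mul_ne_zero Complex.I_ne_zero (Complex.exp_ne_zero _)
  · rw [norm_geodFamily]
  · have hE : ((Real.exp t : ℝ) : ℂ) ≠ 0 := by exact_mod_cast (Real.exp_pos t).ne'
    have hc : ((Real.cos (l * Real.cos (w * t)) : ℝ) : ℂ) ≠ 0 := by exact_mod_cast hcos.ne'
    rw [geodFamily_eq, Complex.ofReal_mul (Real.exp t), Complex.ofReal_div, Complex.ofReal_neg,
      Complex.ofReal_add, Complex.ofReal_one]
    generalize ((Real.exp t : ℝ) : ℂ) = E at *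
    generalize ((Real.cos (l * Real.cos (w * t)) : ℝ) : ℂ) = c at *
    generalize ((Real.sin (l * Real.cos (w * t)) : ℝ) : ℂ) = s at *
    generalize ((-(l * w) * Real.sin (w * t) : ℝ) : ℂ) = p at *
    generalize ((-(l * w ^ 2) * Real.cos (w * t) : ℝ) : ℂ) = b at *
    have key : 1 + Complex.I * (Complex.I * E * (c + s * Complex.I)) / (E * c) -
        Complex.I * (-(s + 1) / c) - Complex.I / c = 0 := by
      field_simp
      linear_combination (c + s * Complex.I) * Complex.I_sq
    linear_combination (Complex.I * E * (c + s * Complex.I)) * (1 + Complex.I * p) ^ 2 * key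

theorem eventually_sin_eq_zero_of_vertex_geodFamily {w : ℝ} (hw : w ≠ 0) :
    ∀ᶠ l in 𝓝[≠] (0 : ℝ), ∀ t,
      deriv (geodesicCurvature fun t => ofComplex (geodFamily w l t)) t = 0 →
      Real.sin (w * t) = 0 := by
  -- Again `(N' Q - 3/2 N Q') / l`, now with value `-(w² + 1)` at `l = 0`.
  have hne := eventually_forall_ne_zero (g := fun l x =>
    (-w ^ 2 * Real.cos (l * x) + l * w ^ 2 * x * Real.sin (l * x) -
      Real.cos (l * x) * (1 + (l * w) ^ 2 * (1 - x ^ 2)) +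
      2 * l * w ^ 2 * x * Real.sin (l * x)) * (1 + (l * w) ^ 2 * (1 - x ^ 2)) +
      3 * l * w ^ 2 * x * (Real.cos (l * x) * (-(l * w ^ 2) * x) -
        Real.sin (l * x) * (1 + (l * w) ^ 2 * (1 - x ^ 2)))) (by fun_prop)
    (fun x => by
      have : 0 < w ^ 2 := by positivity
      simp
      linarith)
  filter_upwards [nhdsWithin_le_nhds hne, nhdsWithin_le_nhds eventually_abs_lt_one,
    self_mem_nhdsWithin] with l hl hl1 hl0 t ht
  rw [funext (geodesicCurvature_geodFamily w hl1)] at ht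
  have hQ := hasDerivAt_speed_sq (l * w) (Real.cos (w * t))
  have hid := hasDerivAt_id (Real.cos (w * t))
  have hN := ((hid.const_mul l).cos.mul (hid.const_mul (-(l * w ^ 2)))).sub
    ((hid.const_mul l).sin.mul hQ)
  refine sin_eq_zero_of_deriv_eq_zero hw hN hQ (speed_sq_pos _ _) ?_ ht
  convert mul_ne_zero hl0 (hl _ (cos_mem_Icc_neg_one_one (w * t))) using 1
  simp
  ring

/-! ### Deck transformations in normal form -/

theorem exists_deck {G : Subgroup (ℍ ≃ᵢ ℍ)} (hG : IsSurfaceGroup G) {L : ℝ}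
    {γ : AddCircle L → Surface G} {c : ℝ → ℍ} (hc : IsLift G γ c) :
    ∃ g ∈ G, ∀ t, g (c t) = c (t + L) :=
  exists_mem_apply_eq_of_proj_eq hG hc.1.continuous
    (hc.1.continuous.comp (continuous_id.add continuous_const))
    fun t => by rw [hc.2]; exact ((hc.2 (t + L)).trans (congrArg γ (AddCircle.coe_add_period L t))).symm

theorem exists_eq_mul_of_sin_eq_zero {L : ℝ} (hL : 0 < L) {m : ℕ} (hm : m = 1 ∨ m = 2) {t : ℝ}
    (h : Real.sin (m * Real.pi / L * t) = 0) : ∃ n : ℤ, t = n * (L / 2) := by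
  obtain ⟨n, hn⟩ := Real.sin_eq_zero_iff.1 h
  have hpi := Real.pi_pos.ne'
  rcases hm with rfl | rfl
  · refine ⟨2 * n, ?_⟩
    field_simp at hn
    push_cast at hn ⊢
    linarith
  · refine ⟨n, ?_⟩
    field_simp at hn
    push_cast at hn ⊢
    linarith

/-- The deck transformation agrees with translation by `L` along the horocycle, hence everywhere: no
reflection fixes a horocycle pointwise. -/
theorem horocycle_close {G : Subgroup (ℍ ≃ᵢ ℍ)} (hG : IsSurfaceGroup G) {L : ℝ} (hL : 0 < L)
    {γ : AddCircle L → Surface G} {c : ℝ → ℍ} (hc : IsLift G γ c) (A : ℍ ≃ᵢ ℍ) {h : ℝ}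
    (hh : 0 < h) (hA : ∀ t : ℝ, (A (c t) : ℂ) = t + h * Complex.I) (k : ℕ) {ε : ℝ} (hε : 0 < ε) :
    ∃ γ' : AddCircle L → Surface G, IsClosedCurve G γ' ∧ γ' ∈ smoothNhd G L c k ε ∧
      {τ : AddCircle L | IsVertex G γ' τ}.encard ≤ 2 := by
  obtain ⟨g, hg, hgc⟩ := exists_deck hG hc
  have hw : ((2 : ℕ) : ℝ) * Real.pi / L ≠ 0 := by positivity
  obtain ⟨S, hS⟩ := exists_isometryEquiv_moebius 1 (-L) 0 1 (by norm_num)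
  have hfix := eq_self_of_fix_horocycle (A.symm.trans (g.trans (A.trans S))) h hh fun z hz => by
    have hz' : A (c z.re) = z := UpperHalfPlane.ext (by rw [hA, ← hz, re_add_im])
    have hmove : A (g (A.symm z)) = A (c (z.re + L)) := by
      rw [← hgc, ← A.symm_apply_apply (c z.re), hz']
    have hzc := hA z.re
    rw [hz'] at hzc
    change S (A (g (A.symm z))) = z
    apply UpperHalfPlane.ext
    rw [hS, hmove, hA, hzc]
    push_cast
    ring
  have hT : ∀ z, (A (g (A.symm z)) : ℂ) = z + L := fun z => by
    have h1 : (S (A (g (A.symm z))) : ℂ) = z := congrArg _ (hfix z)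
    rw [hS] at h1
    rw [← h1]
    push_cast
    ring
  refine exists_close_of_family hG L c k hε hg A (horoFamily h ((2 : ℕ) * Real.pi / L))
    (contDiff_horoFamily _ _) (fun l hl t => horoFamily_im_pos hh _ hl t)
    (fun l _ t => deriv_horoFamily_ne_zero _ _ _ _) (fun t => ?_) (fun l hl t => ?_) ?_
  · rw [hA, horoFamily]
    push_cast
    ring
  · rw [hT, ofComplex_apply_of_im_pos (horoFamily_im_pos hh _ hl t)]
    have : (2 : ℕ) * Real.pi / L * (t + L) = (2 : ℕ) * Real.pi / L * t + 2 * Real.pi := by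
      push_cast
      field_simp
    simp only [horoFamily]
    rw [this, Real.cos_add_two_pi]
    push_cast
    ring
  · filter_upwards [eventually_sin_eq_zero_of_vertex_horoFamily hh hw] with l hl t ht
    exact exists_eq_mul_of_sin_eq_zero hL (Or.inr rfl) (hl t ht)

/-- Agreement along a geodesic fixes the deck transformation only up to reflection in it, so two
frequencies are needed. -/
theorem geodesic_close {G : Subgroup (ℍ ≃ᵢ ℍ)} (hG : IsSurfaceGroup G) {L : ℝ} (hL : 0 < L)
    {γ : AddCircle L → Surface G} {c : ℝ → ℍ} (hc : IsLift G γ c) (A : ℍ ≃ᵢ ℍ)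
    (hA : ∀ t : ℝ, (A (c t) : ℂ) = Complex.I * (Real.exp t : ℝ)) (k : ℕ) {ε : ℝ} (hε : 0 < ε) :
    ∃ γ' : AddCircle L → Surface G, IsClosedCurve G γ' ∧ γ' ∈ smoothNhd G L c k ε ∧
      {τ : AddCircle L | IsVertex G γ' τ}.encard ≤ 2 := by
  obtain ⟨g, hg, hgc⟩ := exists_deck hG hc
  have hexp : Real.exp (-(L / 2)) * Real.exp (L / 2) = 1 := by
    rw [← Real.exp_add]; simp
  have hexp2 : ((Real.exp (L / 2) : ℝ) : ℂ) * ((Real.exp (L / 2) : ℝ) : ℂ) =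
      ((Real.exp L : ℝ) : ℂ) := by
    rw [← Complex.ofReal_mul, ← Real.exp_add, add_halves]
  have hexp1 : ((Real.exp (-(L / 2)) : ℝ) : ℂ) * ((Real.exp (L / 2) : ℝ) : ℂ) = 1 := by
    rw [← Complex.ofReal_mul, hexp, Complex.ofReal_one]
  obtain ⟨S, hS⟩ := exists_isometryEquiv_moebius (Real.exp (-(L / 2))) 0 0 (Real.exp (L / 2))
    (by rw [hexp]; ring)
  have hS' : ∀ z : ℍ, (z : ℂ) = Real.exp L * (S z : ℂ) := fun z => by
    have h0 : ((Real.exp (L / 2) : ℝ) : ℂ) ≠ 0 := by exact_mod_cast (Real.exp_pos _).ne'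
    rw [hS, Complex.ofReal_zero, add_zero, zero_mul, zero_add, ← hexp2]
    field_simp
    linear_combination (-z : ℂ) * hexp1
  have hfix : ∀ t, S (A (g (A.symm (A (c t))))) = A (c t) := fun t => by
    rw [A.symm_apply_apply, hgc]
    apply UpperHalfPlane.ext
    have h0 : ((Real.exp L : ℝ) : ℂ) ≠ 0 := by exact_mod_cast (Real.exp_pos _).ne'
    apply mul_left_cancel₀ h0
    rw [← hS', hA, hA, Real.exp_add]
    push_cast
    ring
  have hclose : ∀ m : ℕ, m = 1 ∨ m = 2 → (∀ l, |l| < 1 → ∀ t,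
      (A (g (A.symm (ofComplex (geodFamily (m * Real.pi / L) l t)))) : ℂ) =
        geodFamily (m * Real.pi / L) l (t + L)) →
      ∃ γ' : AddCircle L → Surface G, IsClosedCurve G γ' ∧ γ' ∈ smoothNhd G L c k ε ∧
        {τ : AddCircle L | IsVertex G γ' τ}.encard ≤ 2 := by
    intro m hm hequiv
    have hw : (m : ℝ) * Real.pi / L ≠ 0 := by rcases hm with rfl | rfl <;> positivity
    refine exists_close_of_family hG L c k hε hg A (geodFamily (m * Real.pi / L))
      (contDiff_geodFamily _) (fun l hl t => geodFamily_im_pos _ hl t)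
      (fun l _ t => deriv_geodFamily_ne_zero _ _ _) (fun t => ?_) hequiv ?_
    · rw [hA, geodFamily]
      simp
    · filter_upwards [eventually_sin_eq_zero_of_vertex_geodFamily hw] with l hl t ht
      exact exists_eq_mul_of_sin_eq_zero hL hm (hl t ht)
  -- The points `i` and `2 i` occur at the parameters `0` and `log 2`. In the reflected case the
  -- angle changes sign, matched by `cos (x + π) = -cos x`.
  rcases eq_or_eq_neg_conj_of_fix (A.symm.trans (g.trans (A.trans S))) (A (c 0))
    (A (c (Real.log 2))) (by rw [hA]; simp)
    (by rw [hA, Real.exp_log two_pos]; push_cast; ring) (hfix 0) (hfix _) with h | h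
  · refine hclose 2 (Or.inr rfl) fun l hl t => ?_
    have h1 : S (A (g (A.symm (ofComplex (geodFamily ((2 : ℕ) * Real.pi / L) l t))))) = _ := h _
    rw [hS', h1, ofComplex_apply_of_im_pos (geodFamily_im_pos _ hl t)]
    have : (2 : ℕ) * Real.pi / L * (t + L) = (2 : ℕ) * Real.pi / L * t + 2 * Real.pi := by
      push_cast
      field_simp
    simp only [geodFamily_eq]
    rw [this, Real.cos_add_two_pi, Real.exp_add t L, Complex.ofReal_mul]
    ring
  · refine hclose 1 (Or.inl rfl) fun l hl t => ?_
    have h1 : (S (A (g (A.symm (ofComplex (geodFamily ((1 : ℕ) * Real.pi / L) l t))))) : ℂ) = _ :=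
      h _
    rw [hS', h1, ofComplex_apply_of_im_pos (geodFamily_im_pos _ hl t)]
    have : (1 : ℕ) * Real.pi / L * (t + L) = (1 : ℕ) * Real.pi / L * t + Real.pi := by
      push_cast
      field_simp
    simp only [geodFamily_eq]
    rw [this, Real.cos_add_pi, mul_neg l, Real.cos_neg, Real.sin_neg, Real.exp_add t L,
      Complex.ofReal_mul]
    simp only [map_mul, map_add, Complex.conj_I, Complex.conj_ofReal, Complex.ofReal_neg]
    ring

/-! ### Normal form of unit speed geodesics -/

/-- Both `(f + f') exp (-t)` and `(f - f') exp t` are constant. -/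
theorem exists_eq_exp_of_deriv_deriv_eq_self {f f' : ℝ → ℝ} (hf : ∀ t, HasDerivAt f (f' t) t)
    (hf' : ∀ t, HasDerivAt f' (f t) t) :
    ∃ a b : ℝ, ∀ t, f t = a * Real.exp t + b * Real.exp (-t) ∧
      f' t = a * Real.exp t - b * Real.exp (-t) := by
  have hexp : ∀ t, HasDerivAt (fun t => Real.exp (-t)) (-Real.exp (-t)) t := fun t => by
    simpa using (hasDerivAt_neg t).exp
  have h1 : ∀ t, HasDerivAt (fun t => (f t + f' t) * Real.exp (-t)) 0 t := fun t =>
    (((hf t).add (hf' t)).mul (hexp t)).congr_deriv (by simp only [Pi.add_apply]; ring)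
  have h2 : ∀ t, HasDerivAt (fun t => (f t - f' t) * Real.exp t) 0 t := fun t =>
    (((hf t).sub (hf' t)).mul (Real.hasDerivAt_exp t)).congr_deriv
      (by simp only [Pi.sub_apply]; ring)
  have c1 := is_const_of_deriv_eq_zero (fun t => (h1 t).differentiableAt) fun t => (h1 t).deriv
  have c2 := is_const_of_deriv_eq_zero (fun t => (h2 t).differentiableAt) fun t => (h2 t).deriv
  refine ⟨(f 0 + f' 0) / 2, (f 0 - f' 0) / 2, fun t => ?_⟩
  have e1 := c1 t 0
  have e2 := c2 t 0
  have e3 : Real.exp t * Real.exp (-t) = 1 := by rw [← Real.exp_add]; simp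
  simp only [neg_zero, Real.exp_zero, mul_one] at e1 e2
  rw [← e1, ← e2]
  constructor
  · linear_combination (-f t) * e3
  · linear_combination (-f' t) * e3

/-- A unit speed geodesic is the image of `t ↦ i exp t` under an isometry. -/
theorem exists_isometryEquiv_geodesic {c : ℝ → ℍ} (hc : IsRegularCurve c)
    (hs : ∀ t, speed c t = 1) (hcov : ∀ t, covAccel c t = 0) :
    ∃ A : ℍ ≃ᵢ ℍ, ∀ t : ℝ, (A (c t) : ℂ) = Complex.I * (Real.exp t : ℝ) := by
  have hy0 : ∀ t, (c t).im ≠ 0 := fun t => (c t).im_ne_zero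
  set v : ℝ → ℂ := deriv (coord c) with hv
  have hx : ∀ t, HasDerivAt (fun t => (c t).re) (v t).re t := fun t =>
    Complex.reCLM.hasFDerivAt.comp_hasDerivAt t (hc.hasDerivAt t)
  have hy : ∀ t, HasDerivAt (fun t => (c t).im) (v t).im t := fun t =>
    Complex.imCLM.hasFDerivAt.comp_hasDerivAt t (hc.hasDerivAt t)
  have hacc : ∀ t, deriv v t = -(Complex.I * v t ^ 2 / ((c t).im : ℂ)) := fun t =>
    eq_neg_of_add_eq_zero_left (hcov t)
  have hx' : ∀ t, HasDerivAt (fun t => (v t).re) (2 * (v t).re * (v t).im / (c t).im) t := by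
    intro t
    refine (Complex.reCLM.hasFDerivAt.comp_hasDerivAt t (hc.hasDerivAt_deriv t)).congr_deriv ?_
    rw [← hv, hacc]
    simp [sq]
    ring
  have hy' : ∀ t, HasDerivAt (fun t => (v t).im)
      (((v t).im ^ 2 - (v t).re ^ 2) / (c t).im) t := by
    intro t
    refine (Complex.imCLM.hasFDerivAt.comp_hasDerivAt t (hc.hasDerivAt_deriv t)).congr_deriv ?_
    rw [← hv, hacc]
    simp [sq]
    ring
  have hunit : ∀ t, (v t).re ^ 2 + (v t).im ^ 2 = (c t).im ^ 2 := by
    intro t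
    have := (div_eq_one_iff_eq (hy0 t)).1 (hs t)
    rw [← this, ← hv, ← Complex.normSq_eq_norm_sq, Complex.normSq_apply]
    ring
  -- The functions `1 / y` and `x / y` are linear in the hyperboloid model, so along a unit speed
  -- geodesic both solve `f'' = f`.
  have hw : ∀ t, HasDerivAt (fun t => 1 / (c t).im) (-(v t).im / (c t).im ^ 2) t := fun t => by
    simp only [one_div]
    exact (hy t).inv (hy0 t)
  have hw' : ∀ t, HasDerivAt (fun t => -(v t).im / (c t).im ^ 2) (1 / (c t).im) t := by
    intro t
    have h0 := hy0 t
    refine ((hy' t).neg.div ((hy t).pow 2) (pow_ne_zero 2 h0)).congr_deriv ?_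
    simp only [Pi.pow_apply, Pi.neg_apply]
    have := hunit t
    field_simp
    norm_num
    linear_combination (c t).im * this
  have hxw : ∀ t, HasDerivAt (fun t => (c t).re / (c t).im)
      ((v t).re / (c t).im - (c t).re * (v t).im / (c t).im ^ 2) t := by
    intro t
    have h0 := hy0 t
    refine ((hx t).div (hy t) h0).congr_deriv ?_
    field_simp
  have hxw' : ∀ t, HasDerivAt
      (fun t => (v t).re / (c t).im - (c t).re * (v t).im / (c t).im ^ 2)
      ((c t).re / (c t).im) t := by
    intro t
    have h0 := hy0 t
    refine (((hx' t).div (hy t) h0).sub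
      (((hx t).mul (hy' t)).div ((hy t).pow 2) (pow_ne_zero 2 h0))).congr_deriv ?_
    simp only [Pi.pow_apply, Pi.mul_apply]
    have := hunit t
    field_simp
    norm_num
    linear_combination (c t).im * (c t).re * this
  obtain ⟨a, b, hab⟩ := exists_eq_exp_of_deriv_deriv_eq_self hw hw'
  obtain ⟨m, n, hmn⟩ := exists_eq_exp_of_deriv_deriv_eq_self hxw hxw'
  have hab0 : 0 < a + b := by
    have := (hab 0).1
    simp at this
    rw [← this]
    exact inv_pos.2 (c 0).im_pos
  have hrel : a * b = (m * b - n * a) ^ 2 := by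
    obtain ⟨e1, e2⟩ := hab 0
    obtain ⟨e3, e4⟩ := hmn 0
    have hu := hunit 0
    have h0 := hy0 0
    simp only [neg_zero, Real.exp_zero, mul_one] at e1 e2 e3 e4
    have h1 : 2 * a = 1 / (c 0).im + -(v 0).im / (c 0).im ^ 2 := by linarith
    have h2 : 2 * b = 1 / (c 0).im - -(v 0).im / (c 0).im ^ 2 := by linarith
    have h3 : m * b - n * a = (v 0).re / (c 0).im ^ 2 / 2 := by
      have : m * b - n * a = ((m - n) * (a + b) - (m + n) * (a - b)) / 2 := by ring
      rw [this, ← e1, ← e2, ← e3, ← e4]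
      field_simp
      ring
    have h4 : 4 * (a * b) = (v 0).re ^ 2 / (c 0).im ^ 4 := by
      have : 4 * (a * b) = (2 * a) * (2 * b) := by ring
      rw [this, h1, h2]
      field_simp
      linear_combination -hu
    rw [h3]
    field_simp at h4 ⊢
    linarith
  have hab1 : 0 ≤ a * b := hrel ▸ sq_nonneg _
  have ha : 0 ≤ a := by
    by_contra! h
    nlinarith
  have hb : 0 ≤ b := by
    by_contra! h
    nlinarith
  -- For the image of `i exp t` under the matrix `(p, q; r, s)` one has `1 / y = r² exp t + s² exp
  -- (-t)` and `x / y = p r exp t + q s exp (-t)`. Comparing coefficients dictates `r`, `s`, then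
  -- `p`, `q`; the condition on `r s` selects the relative sign that makes the determinant `1`.
  obtain ⟨r, s, hr, hs', hrs⟩ : ∃ r s : ℝ, r * r = a ∧ s * s = b ∧ r * s = m * b - n * a := by
    have h1 := Real.mul_self_sqrt ha
    have h2 := Real.mul_self_sqrt hb
    have h3 : (√a * √b) ^ 2 = (m * b - n * a) ^ 2 := by
      rw [mul_pow, Real.sq_sqrt ha, Real.sq_sqrt hb, hrel]
    rcases sq_eq_sq_iff_eq_or_eq_neg.1 h3 with h | h
    · exact ⟨√a, √b, h1, h2, h⟩
    · exact ⟨√a, -√b, h1, by linarith, by linarith⟩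
  obtain ⟨p, q, hp, hq, hdet⟩ : ∃ p q : ℝ, p * r = m ∧ q * s = n ∧ p * s - q * r = 1 := by
    have hne := hab0.ne'
    refine ⟨(s + (m + n) * r) / (a + b), (-r + (m + n) * s) / (a + b), ?_, ?_, ?_⟩
    · rw [div_mul_eq_mul_div, div_eq_iff hne]
      linear_combination hrs + (m + n) * hr
    · rw [div_mul_eq_mul_div, div_eq_iff hne]
      linear_combination -hrs + (m + n) * hs'
    · rw [div_mul_eq_mul_div, div_mul_eq_mul_div, ← sub_div, div_eq_iff hne]
      linear_combination hr + hs'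
  obtain ⟨M, hM⟩ := exists_isometryEquiv_moebius p q r s hdet
  refine ⟨M.symm, fun t => ?_⟩
  obtain ⟨z, hz⟩ : ∃ z : ℍ, (z : ℂ) = Complex.I * (Real.exp t : ℝ) :=
    ⟨⟨Complex.I * (Real.exp t : ℝ), by
      rw [Complex.I_mul_im, Complex.ofReal_re]; exact Real.exp_pos t⟩, rfl⟩
  rw [← hz, show c t = M z from ?_, M.symm_apply_apply]
  apply UpperHalfPlane.ext
  rw [hM, eq_div_iff (denom_ne_zero_of_det hdet z.coe_im_pos), hz]
  have h0 := hy0 t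
  have e1 := (hab t).1
  have e2 := (hmn t).1
  have e3 : Real.exp t * Real.exp (-t) = 1 := by rw [← Real.exp_add]; simp
  rw [div_eq_iff h0] at e1 e2
  have hre : q = (c t).re * s - (c t).im * r * Real.exp t := by
    rw [e2]
    linear_combination q * e1 + (c t).im * Real.exp t * (-q * hr + s * hp - r * hdet) +
      (c t).im * Real.exp (-t) * (-q * hs' + s * hq)
  have him : p * Real.exp t = (c t).re * r * Real.exp t + (c t).im * s := by
    rw [e2]
    linear_combination p * Real.exp t * e1 + (c t).im * (-p * Real.exp t ^ 2 * hr +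
      r * Real.exp t ^ 2 * hp + (p * b - r * n) * e3 - p * hs' + r * hq + s * hdet)
  apply Complex.ext
  · simp [-Complex.ofReal_exp]
    linarith
  · simp [-Complex.ofReal_exp]
    linarith

end HyperbolicSurface

theorem mainTheorem6 (G : Subgroup (ℍ ≃ᵢ ℍ)) (hG : HyperbolicSurface.IsSurfaceGroup G)
    (L : ℝ) (hL : 0 < L) (γ : AddCircle L → HyperbolicSurface.Surface G)
    (hγ : HyperbolicSurface.IsClosedGeodesic G γ ∨ HyperbolicSurface.IsClosedHorocycle G γ)
    (c : ℝ → ℍ) (hc : HyperbolicSurface.IsLift G γ c) (k : ℕ) (ε : ℝ) (hε : 0 < ε) :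
    ∃ γ' : AddCircle L → HyperbolicSurface.Surface G,
      HyperbolicSurface.IsClosedCurve G γ' ∧
      γ' ∈ HyperbolicSurface.smoothNhd G L c k ε ∧
      {τ : AddCircle L | HyperbolicSurface.IsVertex G γ' τ}.encard ≤ 2 := by
  -- The normal form is known for some lift `c₀`, whereas closeness is required for `c`; the
  -- isometry between them is absorbed into `A`.
  have hmove : ∀ c₀, HyperbolicSurface.IsLift G γ c₀ → ∃ g : ℍ ≃ᵢ ℍ, ∀ t, g (c t) = c₀ t :=
    fun c₀ hc₀ => by
      obtain ⟨g, -, hg⟩ := HyperbolicSurface.exists_mem_apply_eq_of_proj_eq hG hc.1.continuous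
        hc₀.1.continuous fun t => (hc.2 t).trans (hc₀.2 t).symm
      exact ⟨g, hg⟩
  rcases hγ with ⟨c₀, hc₀, hs, hcov⟩ | ⟨c₀, hc₀, A, h, hh, hA⟩
  · obtain ⟨g, hg⟩ := hmove c₀ hc₀
    obtain ⟨A, hA⟩ := HyperbolicSurface.exists_isometryEquiv_geodesic hc₀.1 hs hcov
    refine HyperbolicSurface.geodesic_close hG hL hc (g.trans A) (fun t => ?_) k hε
    rw [← hA, ← hg]
    rfl
  · obtain ⟨g, hg⟩ := hmove c₀ hc₀
    refine HyperbolicSurface.horocycle_close hG hL hc (g.trans A) hh (fun t => ?_) k hε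
    rw [← hA, ← hg]
    rfl
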